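/- Let $p$ be a prime and let $G$ be a finite $p$-group of order $p^8$ and nilpotency class $2$ such that the set of sizes of the conjugacy classes of $G$ is $\{1, p^3\}$ (i.e. $G$ is of conjugate type $\{1,p^3\}$) and such that the commutator subgroup $\gamma_2(G)$ is elementary abelian of order $p^4$. Then every element of $\gamma_2(G)$ is a commutator; that is, $\gamma_2(G) = \{[x,y] \mid x, y \in G\}$. -/

import Mathlib

/-- The set of sizes of the conjugacy classes of all elements of `G`. A finite `p`-group is of
conjugate type `S` if this set is equal to `S`. -/
def conjClassSizes (G : Type*) [Group G] : Set ℕ :=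
  Set.range fun x : G => Nat.card (conjugatesOf x)

/-- A group is elementary abelian (for the prime `p`) if it is abelian and every element `x`
satisfies `x ^ p = 1`. -/
def IsElementaryAbelianGroup (p : ℕ) (A : Type*) [Group A] : Prop :=
  (∀ x y : A, x * y = y * x) ∧ ∀ x : A, x ^ p = 1

/-!
Put `Z = Z(G)`. As `G` has class two, `γ₂(G) ≤ Z`. The centralizer of a noncentral `x` has order
`p ^ 5` and contains `Z` properly, so `|Z| ≤ p ^ 4`, whence `γ₂(G) = Z` has order `p ^ 4`, and the
centralizer is generated by `Z` and `x`. Thus `V = G / Z` and `Z` are vector spaces of dimension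
`4` over the field of `p` elements, and the commutator induces an alternating bilinear map
`B : V × V → Z` that vanishes only on linearly dependent pairs.

The map `B` factors through a linear map `φ` on the bivectors of `V`, a space of dimension `6` in
which the decomposable bivectors `x ∧ y` are the zeros of the quadratic Plücker relation
(`exists_minors_eq`). Given `w` in `Z`, the four linear equations `φ a = t • w` and the Plücker
relation in the seven unknowns `(a, t)` have a nontrivial common solution by the Chevalley–Warning
theorem (`exists_ne_zero_map_eq_zero_eval_eq_zero`). Here `a = x ∧ y`, so `B x y = t • w`. If
`t = 0`, then `x` and `y` are dependent, so that `a = 0`, a contradiction; hence `t ≠ 0` and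
`w = B (t⁻¹ • x) y` (`exists_apply_eq_of_alternating`).
-/

/-! ### Alternating bilinear maps over finite fields -/

section Alternating

open Module MvPolynomial

/-- A consequence of the Chevalley–Warning theorem: the kernel of a linear map into `W` contains a
nontrivial zero of `q` as soon as the number of variables exceeds `dim W + deg q`. The linear map
contributes `dim W` polynomials of degree one. -/
theorem exists_ne_zero_map_eq_zero_eval_eq_zero {K : Type*} [Field K] [Finite K]
    {σ : Type*} [Fintype σ] {W : Type*} [AddCommGroup W] [Module K W] [FiniteDimensional K W]
    (ψ : (σ → K) →ₗ[K] W) (q : MvPolynomial σ K) (hq : eval 0 q = 0)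
    (hdeg : finrank K W + q.totalDegree < Fintype.card σ) :
    ∃ v : σ → K, v ≠ 0 ∧ ψ v = 0 ∧ eval v q = 0 := by
  classical
  have := Fintype.ofFinite K
  let b := finBasis K W
  -- `q` itself together with the coordinates of `ψ`
  let f : Option (Fin (finrank K W)) → MvPolynomial σ K := fun o =>
    o.elim q fun i => ∑ j, C (b.repr (ψ (Pi.single j 1)) i) * X j
  have hf (v : σ → K) (i) : eval v (f (some i)) = b.repr (ψ v) i := by
    conv_rhs => rw [LinearMap.pi_apply_eq_sum_univ ψ v]
    have hs (j : σ) : (fun k => if j = k then (1 : K) else 0) = Pi.single j 1 := by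
      ext k; simp [Pi.single_apply, eq_comm]
    simp [f, mul_comm, hs]
  have hsum : ∑ o, (f o).totalDegree < Fintype.card σ := by
    refine lt_of_le_of_lt ?_ hdeg
    rw [Fintype.sum_option, add_comm]
    gcongr
    · refine (Finset.sum_le_card_nsmul _ _ 1 fun i _ => ?_).trans (by simp)
      refine totalDegree_finsetSum_le fun j _ => ?_
      exact (totalDegree_mul _ _).trans (by simp)
    · rfl
  obtain ⟨p, hp⟩ := CharP.exists K
  have hdvd := char_dvd_card_solutions_of_fintype_sum_lt p hsum
  have hzero : ∀ o, eval (0 : σ → K) (f o) = 0 := by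
    rintro (_ | i)
    · exact hq
    · rw [hf, map_zero, map_zero, Finsupp.zero_apply]
  have hpp : 1 < p := (CharP.char_is_prime K p).one_lt
  have hpos := Fintype.card_pos_iff.2 ⟨(⟨0, hzero⟩ :
    {x : σ → K // ∀ o, eval x (f o) = 0})⟩
  obtain ⟨⟨v, hv⟩, hne⟩ := Fintype.exists_ne_of_one_lt_card
    (hpp.trans_le (Nat.le_of_dvd hpos hdvd)) ⟨0, hzero⟩
  refine ⟨v, fun h => hne (Subtype.ext h), ?_, hv none⟩
  apply b.repr.injective
  ext i
  rw [← hf, hv]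
  simp

/-- The Klein quadric: a vector of Plücker coordinates `p₀₁, p₀₂, p₀₃, p₁₂, p₁₃, p₂₃` (in this
order) that satisfies the Plücker relation is the vector of `2 × 2` minors of some pair `x, y`. -/
theorem exists_minors_eq {K : Type*} [Field K] (a : Fin 6 → K)
    (h : a 0 * a 5 - a 1 * a 4 + a 2 * a 3 = 0) :
    ∃ x y : Fin 4 → K,
      x 0 * y 1 - x 1 * y 0 = a 0 ∧ x 0 * y 2 - x 2 * y 0 = a 1 ∧ x 0 * y 3 - x 3 * y 0 = a 2 ∧
      x 1 * y 2 - x 2 * y 1 = a 3 ∧ x 1 * y 3 - x 3 * y 1 = a 4 ∧ x 2 * y 3 - x 3 * y 2 = a 5 := by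
  -- If `pᵢⱼ ≠ 0`, take rows `i` and `j` of the alternating matrix `(pᵢⱼ)`, the former divided
  -- by `pᵢⱼ`. In the last case only `p₂₃` can be nonzero.
  by_cases h0 : a 0 ≠ 0
  · refine ⟨![0, 1, a 1 / a 0, a 2 / a 0], ![-a 0, 0, a 3, a 4], ?_⟩
    simp; field_simp; grind
  by_cases h1 : a 1 ≠ 0
  · refine ⟨![0, a 0 / a 1, 1, a 2 / a 1], ![-a 1, -a 3, 0, a 5], ?_⟩
    simp; field_simp; grind
  by_cases h2 : a 2 ≠ 0
  · refine ⟨![0, a 0 / a 2, a 1 / a 2, 1], ![-a 2, -a 4, -a 5, 0], ?_⟩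
    simp; field_simp; grind
  by_cases h3 : a 3 ≠ 0
  · refine ⟨![-a 0 / a 3, 0, 1, a 4 / a 3], ![-a 1, -a 3, 0, a 5], ?_⟩
    simp; field_simp; grind
  by_cases h4 : a 4 ≠ 0
  · refine ⟨![-a 0 / a 4, 0, a 3 / a 4, 1], ![-a 2, -a 4, -a 5, 0], ?_⟩
    simp; field_simp; grind
  · refine ⟨![0, 0, 1, 0], ![0, 0, 0, a 5], ?_⟩
    simp; grind

/-- An alternating map `V × V → W` with `dim V = 4` and `dim W ≤ 4` that vanishes only on linearly
dependent pairs takes every value in `W`. -/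
theorem exists_apply_eq_of_alternating {K : Type*} [Field K] [Finite K]
    {V W : Type*} [AddCommGroup V] [Module K V] [AddCommGroup W] [Module K W]
    [FiniteDimensional K W] (hV : finrank K V = 4) (hW : finrank K W ≤ 4)
    (B : V →ₗ[K] V →ₗ[K] W) (halt : B.IsAlt)
    (hdep : ∀ x y, x ≠ 0 → B x y = 0 → ∃ c : K, y = c • x) (w : W) :
    ∃ x y, B x y = w := by
  have : FiniteDimensional K V := .of_finrank_pos (by omega)
  -- The form on bivectors `∑ aᵢⱼ eᵢ ∧ eⱼ` that sends `x ∧ y` to `B x y`.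
  let e := finBasisOfFinrankEq K V hV
  let φ : (Fin 6 → K) → W := fun a =>
    a 0 • B (e 0) (e 1) + a 1 • B (e 0) (e 2) + a 2 • B (e 0) (e 3) +
    a 3 • B (e 1) (e 2) + a 4 • B (e 1) (e 3) + a 5 • B (e 2) (e 3)
  -- Seven unknowns: a bivector and a scalar `t`, subject to the linear condition
  -- `φ a = t • w` and the Plücker relation; Chevalley–Warning applies as `4 + 2 < 7`.
  let ψ : (Fin 7 → K) →ₗ[K] W :=
    { toFun v := φ (fun i => v i.castSucc) - v (Fin.last 6) • w
      map_add' v v' := by simp only [φ, Pi.add_apply]; module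
      map_smul' c v := by simp only [φ, Pi.smul_apply, smul_eq_mul, RingHom.id_apply]; module }
  let q : MvPolynomial (Fin 7) K := X 0 * X 5 - X 1 * X 4 + X 2 * X 3
  have hmon (i j : Fin 7) : (X i * X j : MvPolynomial (Fin 7) K).totalDegree ≤ 2 :=
    (totalDegree_mul _ _).trans (by simp)
  have hq : q.totalDegree ≤ 2 :=
    (totalDegree_add _ _).trans (max_le ((totalDegree_sub _ _).trans
      (max_le (hmon _ _) (hmon _ _))) (hmon _ _))
  obtain ⟨v, hv, hψ, hqv⟩ := exists_ne_zero_map_eq_zero_eval_eq_zero ψ q (by simp [q])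
    (by rw [Fintype.card_fin]; omega)
  obtain ⟨x, y, m0, m1, m2, m3, m4, m5⟩ := exists_minors_eq (fun i => v i.castSucc)
    (by simpa [q] using hqv)
  have hB : B (∑ i, x i • e i) (∑ j, y j • e j) = v (Fin.last 6) • w := by
    rw [← sub_eq_zero.1 hψ]
    simp only [φ, ← m0, ← m1, ← m2, ← m3, ← m4, ← m5, Fin.sum_univ_four, map_add, map_smul,
      LinearMap.add_apply, LinearMap.smul_apply, halt.self_eq_zero]
    rw [← halt.neg (e 0) (e 1), ← halt.neg (e 0) (e 2), ← halt.neg (e 0) (e 3),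
      ← halt.neg (e 1) (e 2), ← halt.neg (e 1) (e 3), ← halt.neg (e 2) (e 3)]
    module
  -- If `t = 0`, then `B` kills the decomposable bivector `x ∧ y = a ≠ 0`; otherwise divide by `t`.
  by_cases ht : v (Fin.last 6) = 0
  · exfalso
    have hx (hprop : x = 0 ∨ ∃ c : K, y = c • x) : False := by
      apply hv
      have hzero (i j : Fin 4) : x i * y j - x j * y i = 0 := by
        obtain rfl | ⟨c, rfl⟩ := hprop
        · simp
        · simp; ring
      rw [hzero] at m0 m1 m2 m3 m4 m5
      ext i
      fin_cases i
      exacts [m0.symm, m1.symm, m2.symm, m3.symm, m4.symm, m5.symm, ht]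
    by_cases hx0 : ∑ i, x i • e i = 0
    · refine hx (.inl ?_)
      exact funext (Fintype.linearIndependent_iff.1 e.linearIndependent x hx0)
    · obtain ⟨c, hc⟩ := hdep _ _ hx0 (by rw [hB, ht, zero_smul])
      refine hx (.inr ⟨c, ?_⟩)
      apply e.equivFun.symm.injective
      simpa [Basis.equivFun_symm_apply] using hc
  · exact ⟨(v (Fin.last 6))⁻¹ • ∑ i, x i • e i, ∑ j, y j • e j, by
      rw [map_smul, LinearMap.smul_apply, hB, inv_smul_smul₀ ht]⟩

theorem finrank_zmod_eq_of_natCard_eq_pow {p n : ℕ} [Fact p.Prime] {M : Type*} [AddCommGroup M]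
    [Module (ZMod p) M] (hM : Nat.card M = p ^ n) : finrank (ZMod p) M = n := by
  have hp : p.Prime := Fact.out
  have : Finite M := Nat.finite_of_card_ne_zero (hM ▸ (pow_pos hp.pos n).ne')
  have h := natCard_eq_pow_finrank (K := ZMod p) (V := M)
  rw [Nat.card_zmod, hM] at h
  exact (Nat.pow_right_injective hp.two_le h).symm

theorem exists_apply_eq_of_zmod_alternating {p : ℕ} [Fact p.Prime] {A C : Type*} [AddCommGroup A]
    [AddCommGroup C] [Module (ZMod p) A] [Module (ZMod p) C]
    (hA : Nat.card A = p ^ 4) (hC : Nat.card C = p ^ 4) (f : A →+ A →+ C)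
    (halt : ∀ x, f x x = 0) (hdep : ∀ x y, x ≠ 0 → f x y = 0 → ∃ k : ℤ, y = k • x) (c : C) :
    ∃ x y, f x y = c := by
  have : Finite C :=
    Nat.finite_of_card_ne_zero (hC ▸ (pow_pos (Fact.out : p.Prime).pos 4).ne')
  let B : A →ₗ[ZMod p] A →ₗ[ZMod p] C :=
    AddMonoidHom.toZModLinearMap p <| AddMonoidHom.mk' (fun x => (f x).toZModLinearMap p)
      fun x y => LinearMap.ext fun z => DFunLike.congr_fun (map_add f x y) z
  refine exists_apply_eq_of_alternating (finrank_zmod_eq_of_natCard_eq_pow hA)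
    (finrank_zmod_eq_of_natCard_eq_pow hC).le B halt (fun x y hx hxy => ?_) c
  obtain ⟨k, hk⟩ := hdep x y hx hxy
  exact ⟨k, hk.trans (Int.cast_smul_eq_zsmul (ZMod p) k x).symm⟩

/-- The surjectivity statement `exists_apply_eq_of_alternating` over the field of `p` elements,
for elementary abelian groups of order `p ^ 4` in multiplicative notation. -/
theorem exists_apply_eq_of_elementaryAbelian {p : ℕ} [Fact p.Prime] {A C : Type*} [CommGroup A]
    [CommGroup C] (hA : ∀ x : A, x ^ p = 1) (hC : ∀ x : C, x ^ p = 1)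
    (hcardA : Nat.card A = p ^ 4) (hcardC : Nat.card C = p ^ 4) (f : A →* A →* C)
    (halt : ∀ x, f x x = 1) (hdep : ∀ x y, x ≠ 1 → f x y = 1 → ∃ k : ℤ, y = x ^ k) (c : C) :
    ∃ x y, f x y = c := by
  let : Module (ZMod p) (Additive A) := AddCommGroup.zmodModule hA
  let : Module (ZMod p) (Additive C) := AddCommGroup.zmodModule hC
  let F : Additive A →+ Additive A →+ Additive C :=
    AddMonoidHom.mk' (fun x => MonoidHom.toAdditive (f x.toMul))
      fun x y => AddMonoidHom.ext fun z => DFunLike.congr_fun (map_mul f x.toMul y.toMul) z.toMul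
  exact exists_apply_eq_of_zmod_alternating (p := p) (A := Additive A) (C := Additive C)
    hcardA hcardC F halt hdep (Additive.ofMul c)

end Alternating

/-! ### Groups of class two -/

section ClassTwo

variable {G : Type*} [Group G]

open Subgroup
open scoped IsMulCommutative commutatorElement

/-- In a group of class at most two, the commutator as a bimultiplicative map into the center. -/
def commutatorToCenter (h : commutator G ≤ center G) : G →* G →* center G :=
  have hc (x y : G) : ⁅x, y⁆ ∈ center G :=
    h (commutator_mem_commutator (mem_top x) (mem_top y))
  .mk' (fun x => .mk' (fun y => ⟨⁅x, y⁆, hc x y⟩) fun y z => Subtype.ext <| by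
      change ⁅x, y * z⁆ = ⁅x, y⁆ * ⁅x, z⁆
      rw [commutatorElement_mul_right_eq_mul_conj, mul_assoc ⁅x, y⁆, mem_center_iff.1 (hc x z) y,
        mul_assoc, mul_inv_cancel_right])
    fun x y => MonoidHom.ext fun z => Subtype.ext <| by
      change ⁅x * y, z⁆ = ⁅x, z⁆ * ⁅y, z⁆
      rw [commutatorElement_mul_left_eq_conj_mul, mem_center_iff.1 (hc y z) x,
        mul_inv_cancel_right, mem_center_iff.1 (hc y z)]

theorem coe_commutatorToCenter (h : commutator G ≤ center G) (x y : G) :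
    (commutatorToCenter h x y : G) = ⁅x, y⁆ := rfl

/-- The bimultiplicative map `G / Z(G) × G / Z(G) → Z(G)` induced by the commutator of a group of
class at most two. -/
def commutatorPairing (h : commutator G ≤ center G) :
    (G ⧸ center G) →* (G ⧸ center G) →* center G :=
  QuotientGroup.lift (center G)
    (.mk' (fun x => QuotientGroup.lift (center G) (commutatorToCenter h x) fun _ hz =>
      Subtype.ext (commutatorElement_eq_one_iff_mul_comm.2 (mem_center_iff.1 hz x)))
      fun x y => QuotientGroup.monoidHom_ext _ (map_mul (commutatorToCenter h) x y))
    fun _ hz => QuotientGroup.monoidHom_ext _ <| MonoidHom.ext fun y =>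
      Subtype.ext (commutatorElement_eq_one_iff_mul_comm.2 (mem_center_iff.1 hz y).symm)

theorem pow_quotient_center_eq_one {p : ℕ} (h : commutator G ≤ center G)
    (hexp : ∀ z : center G, z ^ p = 1) (x : G ⧸ center G) : x ^ p = 1 := by
  induction x using QuotientGroup.induction_on with | H x => ?_
  rw [← QuotientGroup.mk_pow, QuotientGroup.eq_one_iff, mem_center_iff]
  intro y
  refine (commutatorElement_eq_one_iff_mul_comm.1 ?_).symm
  rw [← coe_commutatorToCenter h, map_pow, MonoidHom.pow_apply, hexp, coe_one]

theorem card_conjugatesOf_mul_card_centralizer (x : G) :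
    Nat.card (conjugatesOf x) * Nat.card (centralizer {x}) = Nat.card G := by
  rw [nat_card_centralizer_nat_card_stabilizer,
    ← Nat.card_congr (ConjAct.ofConjAct (G := G)).toEquiv,
    ← (MulAction.stabilizer (ConjAct G) x).index_mul_card, MulAction.index_stabilizer,
    ConjAct.orbit_eq_carrier_conjClasses, ← Nat.card_coe_set_eq]
  rfl

theorem card_centralizer_of_conjClassSizes {p : ℕ} (hp : p.Prime) (hcard : Nat.card G = p ^ 8)
    (htype : conjClassSizes G = {1, p ^ 3}) {x : G} (hx : x ∉ center G) :
    Nat.card (centralizer {x}) = p ^ 5 := by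
  have hmul := card_conjugatesOf_mul_card_centralizer x
  have hmem : Nat.card (conjugatesOf x) ∈ conjClassSizes G := ⟨x, rfl⟩
  rw [htype] at hmem
  obtain h | h := hmem
  · refine absurd ?_ hx
    rw [Nat.card_eq_one_iff_unique] at h
    have := h.1
    rw [mem_center_iff]
    intro g
    have := congrArg Subtype.val (Subsingleton.elim (α := conjugatesOf x)
      ⟨g * x * g⁻¹, isConj_iff.2 ⟨g, rfl⟩⟩ ⟨x, mem_conjugatesOf_self⟩)
    exact mul_inv_eq_iff_eq_mul.1 this
  · rw [h, hcard] at hmul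
    exact Nat.eq_of_mul_eq_mul_left (pow_pos hp.pos 3) (hmul.trans (by ring))

/-- If the centralizer of the noncentral element `x` has order `p * |Z(G)|`, it is generated by
`Z(G)` and `x`, so whatever commutes with `x` is a power of `x` modulo the center. -/
theorem exists_zpow_of_commute {p : ℕ} (hp : p.Prime) (hZ : Nat.card (center G) = p ^ 4) {x y : G}
    (hC : Nat.card (centralizer {x}) = p ^ 5) (hx : x ∉ center G) (hxy : Commute x y) :
    ∃ k : ℤ, (y : G ⧸ center G) = (x : G ⧸ center G) ^ k := by
  have hle : center G ⊔ zpowers x ≤ centralizer {x} :=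
    sup_le (center_le_centralizer _) (zpowers_le.2 (mem_centralizer_singleton_iff.2 rfl))
  have hlt : center G < center G ⊔ zpowers x :=
    left_lt_sup.2 fun h => hx (h (mem_zpowers x))
  have hfin : Finite (centralizer {x}) :=
    Nat.finite_of_card_ne_zero (by rw [hC]; exact (pow_pos hp.pos 5).ne')
  have hfin' : Finite (center G ⊔ zpowers x : Subgroup G) :=
    Finite.Set.subset (centralizer {x} : Set G) hle
  have heq : center G ⊔ zpowers x = centralizer {x} := by
    refine eq_of_le_of_card_ge hle ?_
    obtain ⟨k, hk, hkc⟩ := (Nat.dvd_prime_pow hp).1 (hC ▸ card_dvd_of_le hle)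
    have hcard := lt_of_le_of_ne (card_le_of_le hlt.le)
      fun h => hlt.ne (eq_of_le_of_card_ge hlt.le h.ge)
    rw [hZ, hkc, Nat.pow_lt_pow_iff_right hp.one_lt] at hcard
    rw [hC, hkc]
    exact Nat.pow_le_pow_right hp.pos hcard
  have hy : y ∈ center G ⊔ zpowers x :=
    heq ▸ mem_centralizer_singleton_iff.2 hxy.symm
  obtain ⟨z, hz, _, ⟨k, rfl⟩, rfl⟩ := mem_sup_of_normal_left.1 hy
  exact ⟨k, by simp [(QuotientGroup.eq_one_iff z).2 hz]⟩

theorem commutator_le_center_of_nilpotencyClass_eq_two [Group.IsNilpotent G]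
    (h : Group.nilpotencyClass G = 2) : commutator G ≤ center G := by
  have hbot := Subgroup.lowerCentralSeries_nilpotencyClass (G := G)
  rw [h, Subgroup.lowerCentralSeries_succ, top_lowerCentralSeries_one,
    commutator_top_right_eq_bot_iff_le_center] at hbot
  exact hbot

end ClassTwo

open Subgroup in
open scoped IsMulCommutative commutatorElement in
theorem mainTheorem9 (p : ℕ) (hp : p.Prime) (G : Type*) [Group G] [Group.IsNilpotent G]
    (hcard : Nat.card G = p ^ 8)
    (hclass : Group.nilpotencyClass G = 2)
    (htype : conjClassSizes G = {1, p ^ 3})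
    (hcomm_card : Nat.card (commutator G) = p ^ 4)
    (hcomm_elem : IsElementaryAbelianGroup p (commutator G)) :
    commutatorSet G = (commutator G : Set G) := by
  have : Fact p.Prime := ⟨hp⟩
  have : Finite G := Nat.finite_of_card_ne_zero (by rw [hcard]; exact (pow_pos hp.pos 8).ne')
  have hle := commutator_le_center_of_nilpotencyClass_eq_two hclass
  obtain ⟨g, hg⟩ : ∃ g : G, g ∉ center G := by
    by_contra! h
    have hbot : commutator G = ⊥ :=
      commutator_top_right_eq_bot_iff_le_center.2 fun x _ => h x
    rw [hbot, card_bot] at hcomm_card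
    exact (Nat.one_lt_pow four_ne_zero hp.one_lt).ne hcomm_card
  have hC {x : G} (hx : x ∉ center G) := card_centralizer_of_conjClassSizes hp hcard htype hx
  have hZ : Nat.card (center G) = p ^ 4 := by
    refine le_antisymm ?_ (hcomm_card ▸ card_le_of_le hle)
    obtain ⟨k, hk, hkc⟩ := (Nat.dvd_prime_pow hp).1
      (hC hg ▸ card_dvd_of_le (center_le_centralizer {g}))
    rw [hkc]
    refine Nat.pow_le_pow_right hp.pos (Nat.le_of_lt_succ (lt_of_le_of_ne hk ?_))
    rintro rfl
    have : centralizer {g} ≤ center G :=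
      (eq_of_le_of_card_ge (center_le_centralizer {g}) (by rw [hkc, hC hg])).ge
    exact hg (this (mem_centralizer_singleton_iff.2 rfl))
  have heq : commutator G = center G := eq_of_le_of_card_ge hle (by rw [hZ, hcomm_card])
  have hexpZ (z : center G) : z ^ p = 1 := by
    have := hcomm_elem.2 ⟨z, heq.ge z.2⟩
    exact Subtype.ext (congrArg (fun u : commutator G => (u : G)) this)
  have : IsMulCommutative (G ⧸ center G) := Normal.quotient_commutative_iff_commutator_le.2 hle
  have hV : Nat.card (G ⧸ center G) = p ^ 4 := by
    have h := (center G).card_eq_card_quotient_mul_card_subgroup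
    rw [hcard, hZ] at h
    exact Nat.eq_of_mul_eq_mul_right (pow_pos hp.pos 4) (h.symm.trans (by ring))
  refine Set.Subset.antisymm ?_ fun w hw => ?_
  · rintro _ ⟨x, y, rfl⟩
    exact commutator_mem_commutator (mem_top x) (mem_top y)
  have hdep (x y : G ⧸ center G) (hx : x ≠ 1) (hxy : commutatorPairing hle x y = 1) :
      ∃ k : ℤ, y = x ^ k := by
    obtain ⟨x, rfl⟩ := QuotientGroup.mk_surjective x
    obtain ⟨y, rfl⟩ := QuotientGroup.mk_surjective y
    have hx' : x ∉ center G := fun h => hx ((QuotientGroup.eq_one_iff x).2 h)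
    exact exists_zpow_of_commute hp hZ (hC hx') hx'
      (commutatorElement_eq_one_iff_mul_comm.1 (congrArg Subtype.val hxy))
  have halt (x : G ⧸ center G) : commutatorPairing hle x x = 1 := by
    obtain ⟨x, rfl⟩ := QuotientGroup.mk_surjective x
    exact Subtype.ext (commutatorElement_self x)
  obtain ⟨x, y, hxy⟩ := exists_apply_eq_of_elementaryAbelian (pow_quotient_center_eq_one hle hexpZ)
    hexpZ hV hZ (commutatorPairing hle) halt hdep ⟨w, hle hw⟩
  obtain ⟨x, rfl⟩ := QuotientGroup.mk_surjective x
  obtain ⟨y, rfl⟩ := QuotientGroup.mk_surjective y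
  exact ⟨x, y, congrArg Subtype.val hxy⟩
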